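/- Let $p\in(0,1)$ and $q<0$ with $\frac1p+\frac1q=1$, and let $X_1,\dots,X_n$ be independent nonnegative random variables such that $X_1\ge_{\mathrm{lr}}X_2\ge_{\mathrm{lr}}\cdots\ge_{\mathrm{lr}}X_n$ and such that, for each $i$, $X_i^p$ has a log-concave density, that is, a Lebesgue density $h:\mathbb R\to[0,\infty)$ with $h(\alpha x+(1-\alpha)y)\ge h(x)^\alpha h(y)^{1-\alpha}$ for all $x,y\in\mathbb R$ and $\alpha\in[0,1]$. Let $a=(a_1,\dots,a_n)$ and $b=(b_1,\dots,b_n)$ be vectors with positive entries. Then $$(a_1^q,\dots,a_n^q)\succeq^{\mathrm w}(b_1^q,\dots,b_n^q)\quad\Longrightarrow\quad \sum_{i=1}^n a_{(n-i+1)}X_i\ \ge_{\mathrm{st}}\ \sum_{i=1}^n b_{(n-i+1)}X_i .$$ Here $x_{(1)}\le\cdots\le x_{(n)}$ denotes the increasing arrangement of the components of $x\in\mathbb R^n$, and $x\succeq^{\mathrm w}y$ means that $\sum_{i=1}^j x_{(i)}\le\sum_{i=1}^j y_{(i)}$ for $j=1,\dots,n$ (so $y$ is weakly supmajorized by $x$).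 For random variables, $Y\ge_{\mathrm{st}}X$ means $P(Y\le t)\le P(X\le t)$ for all $t\in\mathbb R$. For random variables with Lebesgue densities, $Y\ge_{\mathrm{lr}}X$ means that, for suitable versions $f$ and $g$ of the densities of $X$ and $Y$ respectively, the ratio $g(x)/f(x)\in[0,\infty]$ is nondecreasing over the set of $x$ at which $f(x)$ and $g(x)$ are not both $0$ (with $c/0=\infty$ for $c>0$). -/

import Mathlib

open MeasureTheory ProbabilityTheory
open scoped NNReal ENNReal

/-- `f` is a density function of the real random variable `X` under `μ`
(with respect to Lebesgue measure). -/
def IsDensityOf {Ω : Type*} [MeasurableSpace Ω] (μ : Measure Ω) (X : Ω → ℝ) (f : ℝ → ℝ≥0) : Prop :=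
  Measurable f ∧ μ.map X = (volume : Measure ℝ).withDensity (fun x => (f x : ℝ≥0∞))

/-- A nonnegative function `h` is log-concave on the set `A`. -/
def LogConcaveOn (A : Set ℝ) (h : ℝ → ℝ≥0) : Prop :=
  Convex ℝ A ∧ ∀ x ∈ A, ∀ y ∈ A, ∀ α : ℝ, 0 ≤ α → α ≤ 1 →
    h x ^ α * h y ^ (1 - α) ≤ h (α * x + (1 - α) * y)

/-- `X` has a log-concave density: some version of its density is log-concave on the real line
(a density that is log-concave on a convex set and vanishes outside it is of this kind). -/
def HasLogConcaveDensity {Ω : Type*} [MeasurableSpace Ω] (μ : Measure Ω) (X : Ω → ℝ) : Prop :=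
  ∃ f : ℝ → ℝ≥0, IsDensityOf μ X f ∧ LogConcaveOn Set.univ f

/-- The usual stochastic order `X ≤_st Y`: the distribution functions `F` of `X` and `G` of `Y`
satisfy `G t ≤ F t` for all `t`. -/
def StochLE {Ω : Type*} [MeasurableSpace Ω] (μ : Measure Ω) (X Y : Ω → ℝ) : Prop :=
  ∀ t : ℝ, μ {ω | Y ω ≤ t} ≤ μ {ω | X ω ≤ t}

/-- The likelihood ratio order `X ≤_lr Y` for random variables with densities: for some versions
`f`, `g` of the densities of `X`, `Y`, the ratio `g x / f x` is increasing over the points `x` at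
which it is well defined, i.e. not of the form `0 / 0`. The ratio is taken in `[0, ∞]`, where
`c / 0 = ∞` for `c > 0`. -/
def LikelihoodRatioLE {Ω : Type*} [MeasurableSpace Ω] (μ : Measure Ω) (X Y : Ω → ℝ) : Prop :=
  ∃ f g : ℝ → ℝ≥0, IsDensityOf μ X f ∧ IsDensityOf μ Y g ∧
    MonotoneOn (fun x => (g x : ℝ≥0∞) / (f x : ℝ≥0∞)) {x | ¬ (f x = 0 ∧ g x = 0)}

/-- The increasing arrangement of the components of `x`: with indices counted from `0`,
`orderStat x i` is the component `x_(i+1)`, and `orderStat x i.rev` is `x_(n-i)`. -/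
noncomputable def orderStat {n : ℕ} (x : Fin n → ℝ) : Fin n → ℝ := x ∘ Tuple.sort x

/-- `x` is weakly supmajorized by `y`: for every `j`, the sum of the `j` smallest
components of `x` is at least the sum of the `j` smallest components of `y`. -/
def WeakSupmajorizedBy {n : ℕ} (x y : Fin n → ℝ) : Prop :=
  ∀ j : Fin n, ∑ i ∈ Finset.Iic j, orderStat y i ≤ ∑ i ∈ Finset.Iic j, orderStat x i

/-! Put r = 1/p, so 1 - r = 1/q < 0. If c is the increasing arrangement of the a_i^q, the weight of
X_i is c_i^(1-r), and the hypothesis becomes a comparison of partial sums of increasing vectors c.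
It remains to see how Q(c) = P(∑ c_i^(1-r) X_i ≤ t) changes with c.

Raising an entry lowers a weight, hence raises Q since X_i ≥ 0. For a pair of consecutive entries,
condition on the other summands and write X_i = |U_i|^r with U_i of log-concave density. Since (c,
u) ↦ c^(1-r)|u|^r is jointly convex, Prékopa–Leindler makes the conditional probability log-concave
in the pair (`prod_measure_rpow_le_logConcave`). Swapping an increasing pair does not lower it, by
the likelihood ratio order (`prod_measure_le_swap`). A pair with the same sum lying in between is a
convex combination of the pair and its swap, so its probability is at least that of the original
pair (`prod_measure_le_of_transfer`).

Weak supermajorization decomposes into raising the largest entry and such transfers. They are kept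
adjacent because only consecutive X_i are compared. -/

/-! ### One-dimensional Brunn–Minkowski inequality -/

-- Translating K by min L and L by max K gives two subsets of C that meet at most in the point max K
-- + min L.
open scoped Pointwise in
theorem volume_add_volume_le_of_isCompact {K L C : Set ℝ} (hK : IsCompact K) (hL : IsCompact L)
    (hK0 : K.Nonempty) (hL0 : L.Nonempty) (h : ∀ x ∈ K, ∀ y ∈ L, x + y ∈ C) :
    volume K + volume L ≤ volume C := by
  obtain ⟨m, hmK, hm⟩ := hK.exists_isGreatest hK0
  obtain ⟨l, hlL, hl⟩ := hL.exists_isLeast hL0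
  have hsub : (l +ᵥ K) ∪ (m +ᵥ L) ⊆ C := by
    rintro _ (⟨x, hx, rfl⟩ | ⟨y, hy, rfl⟩)
    · simpa [add_comm] using h x hx l hlL
    · exact h m hmK y hy
  have hdis : AEDisjoint volume (l +ᵥ K) (m +ᵥ L) := by
    refine measure_mono_null (t := {m + l}) ?_ (by simp)
    rintro _ ⟨⟨x, hx, rfl⟩, y, hy, hxy⟩
    have h1 := hm hx
    have h2 := hl hy
    simp only [vadd_eq_add] at hxy
    simp only [vadd_eq_add, Set.mem_singleton_iff]
    linarith
  calc volume K + volume L = volume (l +ᵥ K) + volume (m +ᵥ L) := by simp [measure_vadd]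
    _ = volume ((l +ᵥ K) ∪ (m +ᵥ L)) :=
        (measure_union₀ (hL.vadd m).measurableSet.nullMeasurableSet hdis).symm
    _ ≤ volume C := measure_mono hsub

theorem volume_add_volume_le {A B C : Set ℝ} (hA : MeasurableSet A) (hB : MeasurableSet B)
    (hA0 : A.Nonempty) (hB0 : B.Nonempty) (h : ∀ x ∈ A, ∀ y ∈ B, x + y ∈ C) :
    volume A + volume B ≤ volume C := by
  obtain ⟨a, ha⟩ := hA0
  obtain ⟨b, hb⟩ := hB0
  rw [hA.measure_eq_iSup_isCompact, hB.measure_eq_iSup_isCompact]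
  simp only [iSup_and']
  refine ENNReal.biSup_add_biSup_le' ⟨∅, by simp⟩ ⟨∅, by simp⟩ ?_
  rintro K ⟨hKA, hK⟩ L ⟨hLB, hL⟩
  -- An inner compact set may be empty, so a point of A or B is adjoined to it.
  refine le_trans (add_le_add (measure_mono (Set.subset_insert a K))
    (measure_mono (Set.subset_insert b L))) ?_
  refine volume_add_volume_le_of_isCompact (hK.insert a) (hL.insert b) (Set.insert_nonempty _ _)
    (Set.insert_nonempty _ _) fun x hx y hy => h x ?_ y ?_
  · exact Set.insert_subset ha hKA hx
  · exact Set.insert_subset hb hLB hy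

/-- The one-dimensional Brunn–Minkowski inequality. -/
theorem brunn_minkowski_real {α β : ℝ} (hα : 0 < α) (hβ : 0 < β) {A B C : Set ℝ}
    (hA : MeasurableSet A) (hB : MeasurableSet B) (hA0 : A.Nonempty) (hB0 : B.Nonempty)
    (h : ∀ x ∈ A, ∀ y ∈ B, α * x + β * y ∈ C) :
    ENNReal.ofReal α * volume A + ENNReal.ofReal β * volume B ≤ volume C := by
  have key := volume_add_volume_le (A := (fun x => α⁻¹ * x) ⁻¹' A) (B := (fun x => β⁻¹ * x) ⁻¹' B)
    (C := C) (hA.preimage (measurable_const_mul _)) (hB.preimage (measurable_const_mul _)) ?_ ?_ ?_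
  · rw [Real.volume_preimage_mul_left (inv_ne_zero hα.ne'),
      Real.volume_preimage_mul_left (inv_ne_zero hβ.ne')] at key
    simpa [abs_of_pos hα, abs_of_pos hβ] using key
  · obtain ⟨a, ha⟩ := hA0
    exact ⟨α * a, by simpa [hα.ne'] using ha⟩
  · obtain ⟨b, hb⟩ := hB0
    exact ⟨β * b, by simpa [hβ.ne'] using hb⟩
  · intro x hx y hy
    have := h _ hx _ hy
    rwa [mul_inv_cancel_left₀ hα.ne', mul_inv_cancel_left₀ hβ.ne'] at this

/-! ### Prékopa–Leindler inequality in dimensions one and two -/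

theorem lintegral_eq_lintegral_meas_ofReal_lt {F : ℝ → ℝ≥0∞} (hF : Measurable F)
    (hF1 : ∀ x, F x ≤ 1) :
    ∫⁻ x, F x = ∫⁻ t in Set.Ioi (0 : ℝ), volume {x | ENNReal.ofReal t < F x} := by
  have hfin : ∀ x, F x ≠ ⊤ := fun x => ((hF1 x).trans_lt ENNReal.one_lt_top).ne
  have := lintegral_eq_lintegral_meas_lt (f := fun x => (F x).toReal) volume
    (Filter.Eventually.of_forall fun x => ENNReal.toReal_nonneg) hF.ennreal_toReal.aemeasurable
  simp only [ENNReal.ofReal_toReal (hfin _)] at this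
  rw [this]
  refine setLIntegral_congr_fun measurableSet_Ioi fun t ht => ?_
  congr 1
  ext x
  simp only [Set.mem_ofPred_eq]
  rw [ENNReal.ofReal_lt_iff_lt_toReal (le_of_lt ht) (hfin x)]

theorem ENNReal.geom_mean_le_arith_mean {α β : ℝ} (hα : 0 < α) (hβ : 0 < β) (hαβ : α + β = 1)
    (x y : ℝ≥0∞) : x ^ α * y ^ β ≤ ENNReal.ofReal α * x + ENNReal.ofReal β * y := by
  have hpq : (α⁻¹).HolderConjugate β⁻¹ := by
    rw [Real.holderConjugate_iff]
    refine ⟨?_, by simpa using hαβ⟩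
    exact (one_lt_inv₀ hα).2 (by linarith)
  have := ENNReal.young_inequality (x ^ α) (y ^ β) hpq
  rw [← ENNReal.rpow_mul, ← ENNReal.rpow_mul, mul_inv_cancel₀ hα.ne', mul_inv_cancel₀ hβ.ne',
    ENNReal.rpow_one, ENNReal.rpow_one, ENNReal.ofReal_inv_of_pos hα,
    ENNReal.ofReal_inv_of_pos hβ, div_eq_mul_inv, div_eq_mul_inv, inv_inv, inv_inv] at this
  rwa [mul_comm _ x, mul_comm _ y]

/-- Brunn–Minkowski is applied to superlevel sets and integrated over the level. Equal suprema make
both sets nonempty for exactly the same levels, which yields the arithmetic mean on the left. -/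
theorem prekopa_leindler_of_iSup_eq_one {α β : ℝ} (hα : 0 < α) (hβ : 0 < β) (hαβ : α + β = 1)
    {F G H : ℝ → ℝ≥0∞} (hF : Measurable F) (hG : Measurable G) (hH : Measurable H)
    (hF1 : ⨆ x, F x = 1) (hG1 : ⨆ x, G x = 1)
    (h : ∀ x y, F x ^ α * G y ^ β ≤ H (α * x + β * y)) :
    ENNReal.ofReal α * (∫⁻ x, F x) + ENNReal.ofReal β * (∫⁻ x, G x) ≤ ∫⁻ x, H x := by
  have hF1' : ∀ x, F x ≤ 1 := fun x => hF1 ▸ le_iSup F x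
  have hG1' : ∀ x, G x ≤ 1 := fun x => hG1 ▸ le_iSup G x
  have hHle : ∫⁻ x, min (H x) 1 ≤ ∫⁻ x, H x := lintegral_mono fun x => min_le_left _ _
  refine le_trans ?_ hHle
  have hanti : ∀ E : ℝ → ℝ≥0∞, Measurable fun t : ℝ => volume {x | ENNReal.ofReal t < E x} := by
    intro E
    refine Antitone.measurable fun s t hst => measure_mono fun x hx => ?_
    exact (ENNReal.ofReal_le_ofReal hst).trans_lt hx
  rw [lintegral_eq_lintegral_meas_ofReal_lt hF hF1', lintegral_eq_lintegral_meas_ofReal_lt hG hG1',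
    lintegral_eq_lintegral_meas_ofReal_lt (hH.min measurable_const) fun x => min_le_right _ _,
    ← lintegral_const_mul _ (hanti F), ← lintegral_const_mul _ (hanti G),
    ← lintegral_add_left ((hanti F).const_mul _)]
  refine setLIntegral_mono (hanti _) fun t ht => ?_
  rcases lt_or_ge t 1 with ht1 | ht1
  · have ht1' : ENNReal.ofReal t < 1 := by simpa using ht1
    have ht0 : ENNReal.ofReal t ≠ 0 := by simpa using ht
    refine brunn_minkowski_real hα hβ (hF measurableSet_Ioi) (hG measurableSet_Ioi) ?_ ?_ ?_
    · rw [← hF1] at ht1'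
      exact lt_iSup_iff.1 ht1'
    · rw [← hG1] at ht1'
      exact lt_iSup_iff.1 ht1'
    · intro x hx y hy
      refine lt_min (lt_of_lt_of_le ?_ (h x y)) ht1'
      calc ENNReal.ofReal t = ENNReal.ofReal t ^ α * ENNReal.ofReal t ^ β := by
            rw [← ENNReal.rpow_add _ _ ht0 ENNReal.ofReal_ne_top, hαβ, ENNReal.rpow_one]
        _ < F x ^ α * G y ^ β :=
            ENNReal.mul_lt_mul (ENNReal.rpow_lt_rpow hx hα) (ENNReal.rpow_lt_rpow hy hβ)
  · have h1 : (1 : ℝ≥0∞) ≤ ENNReal.ofReal t := by simpa using ht1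
    have e : ∀ E : ℝ → ℝ≥0∞, (∀ x, E x ≤ 1) → {x | ENNReal.ofReal t < E x} = ∅ := fun E hE =>
      Set.eq_empty_of_forall_notMem fun x hx => absurd hx (not_lt.2 ((hE x).trans h1))
    simp [e F hF1', e G hG1']

/-- The inequality is homogeneous under scaling F and G, so both suprema may be normalized to 1; the
arithmetic mean then dominates the geometric one. -/
theorem prekopa_leindler_of_bounded {α β : ℝ} (hα : 0 < α) (hβ : 0 < β) (hαβ : α + β = 1)
    {F G H : ℝ → ℝ≥0∞} (hF : Measurable F) (hG : Measurable G) (hH : Measurable H)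
    (hFb : ⨆ x, F x ≠ ⊤) (hGb : ⨆ x, G x ≠ ⊤)
    (h : ∀ x y, F x ^ α * G y ^ β ≤ H (α * x + β * y)) :
    (∫⁻ x, F x) ^ α * (∫⁻ x, G x) ^ β ≤ ∫⁻ x, H x := by
  set S := ⨆ x, F x with hS
  set T := ⨆ x, G x with hT
  rcases eq_or_ne S 0 with hS0 | hS0
  · have : ∀ x, F x = 0 := fun x => le_antisymm (hS0 ▸ le_iSup F x) bot_le
    simp [this, hα]
  rcases eq_or_ne T 0 with hT0 | hT0
  · have : ∀ x, G x = 0 := fun x => le_antisymm (hT0 ▸ le_iSup G x) bot_le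
    simp [this, hβ]
  have key := prekopa_leindler_of_iSup_eq_one hα hβ hαβ (F := fun x => S⁻¹ * F x)
    (G := fun x => T⁻¹ * G x) (H := fun x => (S⁻¹ ^ α * T⁻¹ ^ β) * H x) (hF.const_mul _)
    (hG.const_mul _) (hH.const_mul _) (by rw [← ENNReal.mul_iSup, ENNReal.inv_mul_cancel hS0 hFb])
    (by rw [← ENNReal.mul_iSup, ENNReal.inv_mul_cancel hT0 hGb]) ?_
  · rw [lintegral_const_mul _ hF, lintegral_const_mul _ hG, lintegral_const_mul _ hH] at key
    have key2 := (ENNReal.geom_mean_le_arith_mean hα hβ hαβ _ _).trans key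
    rw [ENNReal.mul_rpow_of_nonneg _ _ hα.le, ENNReal.mul_rpow_of_nonneg _ _ hβ.le,
      mul_mul_mul_comm] at key2
    clear_value S T
    refine (ENNReal.mul_le_mul_iff_right ?_ ?_).1 key2
    · refine mul_ne_zero ?_ ?_ <;> simp [ENNReal.rpow_eq_zero_iff, hS0, hT0, hFb, hGb]
    · refine ENNReal.mul_ne_top ?_ ?_ <;> simp [ENNReal.rpow_eq_top_iff, hS0, hT0, hFb, hGb]
  · intro x y
    rw [ENNReal.mul_rpow_of_nonneg _ _ hα.le, ENNReal.mul_rpow_of_nonneg _ _ hβ.le,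
      mul_mul_mul_comm]
    exact mul_le_mul_right (h x y) _

theorem tendsto_lintegral_min_natCast {F : ℝ → ℝ≥0∞} (hF : Measurable F) :
    Filter.Tendsto (fun N : ℕ => ∫⁻ x, min (F x) N) Filter.atTop (nhds (∫⁻ x, F x)) := by
  refine lintegral_tendsto_of_tendsto_of_monotone
    (fun N => (hF.min measurable_const).aemeasurable) (.of_forall fun x N M hNM => ?_)
    (.of_forall fun x => ?_)
  · exact min_le_min_left _ (by exact_mod_cast hNM)
  · have := (tendsto_const_nhds (x := F x)).min ENNReal.tendsto_nat_nhds_top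
    simpa using this

/-- The one-dimensional Prékopa–Leindler inequality. -/
theorem prekopa_leindler_real {α β : ℝ} (hα : 0 < α) (hβ : 0 < β) (hαβ : α + β = 1)
    {F G H : ℝ → ℝ≥0∞} (hF : Measurable F) (hG : Measurable G) (hH : Measurable H)
    (h : ∀ x y, F x ^ α * G y ^ β ≤ H (α * x + β * y)) :
    (∫⁻ x, F x) ^ α * (∫⁻ x, G x) ^ β ≤ ∫⁻ x, H x := by
  rcases eq_or_ne (∫⁻ x, F x) 0 with hF0 | hF0
  · simp [hF0, hα]
  rcases eq_or_ne (∫⁻ x, G x) 0 with hG0 | hG0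
  · simp [hG0, hβ]
  -- Truncation at N removes boundedness. Both integrals being nonzero excludes the indeterminate
  -- product 0 · ∞ in the limit.
  have hlim := ENNReal.Tendsto.mul
    ((ENNReal.continuous_rpow_const (y := α)).continuousAt.tendsto.comp
      (tendsto_lintegral_min_natCast hF))
    (by left; simp [ENNReal.rpow_eq_zero_iff, hF0, hα.le])
    ((ENNReal.continuous_rpow_const (y := β)).continuousAt.tendsto.comp
      (tendsto_lintegral_min_natCast hG))
    (by left; simp [ENNReal.rpow_eq_zero_iff, hG0, hβ.le])
  refine le_of_tendsto' hlim fun N => ?_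
  have hb : ∀ E : ℝ → ℝ≥0∞, ⨆ x, min (E x) (N : ℝ≥0∞) ≠ ⊤ := fun E =>
    ((iSup_le fun x => min_le_right _ _).trans_lt (ENNReal.natCast_lt_top N)).ne
  refine prekopa_leindler_of_bounded hα hβ hαβ (hF.min measurable_const)
    (hG.min measurable_const) hH (hb F) (hb G) fun x y => le_trans ?_ (h x y)
  exact mul_le_mul' (ENNReal.rpow_le_rpow (min_le_left _ _) hα.le)
    (ENNReal.rpow_le_rpow (min_le_left _ _) hβ.le)

/-- The two-dimensional Prékopa–Leindler inequality. -/
theorem prekopa_leindler_real_prod {α β : ℝ} (hα : 0 < α) (hβ : 0 < β) (hαβ : α + β = 1)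
    {F G H : ℝ × ℝ → ℝ≥0∞} (hF : Measurable F) (hG : Measurable G) (hH : Measurable H)
    (h : ∀ z w, F z ^ α * G w ^ β ≤ H (α • z + β • w)) :
    (∫⁻ z, F z) ^ α * (∫⁻ z, G z) ^ β ≤ ∫⁻ z, H z := by
  rw [Measure.volume_eq_prod, lintegral_prod _ hF.aemeasurable, lintegral_prod _ hG.aemeasurable,
    lintegral_prod _ hH.aemeasurable]
  refine prekopa_leindler_real hα hβ hαβ hF.lintegral_prod_right' hG.lintegral_prod_right'
    hH.lintegral_prod_right' fun x y => ?_
  -- Applied to sections, the one-dimensional inequality supplies the hypothesis for the marginals.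
  refine prekopa_leindler_real hα hβ hαβ (hF.comp measurable_prodMk_left)
    (hG.comp measurable_prodMk_left) (hH.comp measurable_prodMk_left) fun u v => ?_
  exact h (x, u) (y, v)

/-! ### Swapping and averaging two weights -/

/-- A monotone likelihood ratio `g / f` yields total positivity of order two. -/
theorem mul_le_mul_of_monotoneOn_div {f g : ℝ → ℝ≥0}
    (h : MonotoneOn (fun x => (g x : ℝ≥0∞) / (f x : ℝ≥0∞)) {x | ¬ (f x = 0 ∧ g x = 0)})
    {x y : ℝ} (hyx : y ≤ x) : g y * f x ≤ g x * f y := by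
  by_cases hx : f x = 0
  · simp [hx]
  by_cases hgy : g y = 0
  · simp [hgy]
  have hle : (g y : ℝ≥0∞) / (f y : ℝ≥0∞) ≤ (g x : ℝ≥0∞) / (f x : ℝ≥0∞) :=
    h (a := y) (b := x) (fun H => hgy H.2) (fun H => hx H.1) hyx
  by_cases hy : f y = 0
  · exfalso
    rw [hy, ENNReal.coe_zero, ENNReal.div_zero (by simpa using hgy), top_le_iff] at hle
    exact ENNReal.div_ne_top ENNReal.coe_ne_top (by simpa using hx) hle
  · simp only [← ENNReal.coe_div hx, ← ENNReal.coe_div hy, ENNReal.coe_le_coe] at hle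
    rwa [div_le_div_iff₀ (pos_iff_ne_zero.2 hy) (pos_iff_ne_zero.2 hx)] at hle

/-- Giving the larger coefficient to the variable which is larger in the likelihood ratio order
makes the linear combination stochastically larger. -/
theorem prod_measure_le_swap {f g : ℝ → ℝ≥0} (hf : Measurable f) (hg : Measurable g)
    (hfg : ∀ x y, y ≤ x → g y * f x ≤ g x * f y)
    [IsFiniteMeasure ((volume : Measure ℝ).withDensity fun x => (f x : ℝ≥0∞))]
    [IsFiniteMeasure ((volume : Measure ℝ).withDensity fun x => (g x : ℝ≥0∞))]
    {α β : ℝ} (hβα : β ≤ α) (s : ℝ) :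
    ((volume.withDensity fun x => (g x : ℝ≥0∞)).prod (volume.withDensity fun x => (f x : ℝ≥0∞)))
        {z : ℝ × ℝ | α * z.1 + β * z.2 ≤ s} ≤
      ((volume.withDensity fun x => (g x : ℝ≥0∞)).prod (volume.withDensity fun x => (f x : ℝ≥0∞)))
        {z : ℝ × ℝ | β * z.1 + α * z.2 ≤ s} := by
  set A := {z : ℝ × ℝ | α * z.1 + β * z.2 ≤ s} with hA
  set B := {z : ℝ × ℝ | β * z.1 + α * z.2 ≤ s} with hB
  have mA : MeasurableSet A := measurableSet_le (by fun_prop) measurable_const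
  have mB : MeasurableSet B := measurableSet_le (by fun_prop) measurable_const
  rw [prod_withDensity hg.coe_nnreal_ennreal hf.coe_nnreal_ennreal]
  set m := (volume.prod volume : Measure (ℝ × ℝ)).withDensity
    fun z => (g z.1 : ℝ≥0∞) * (f z.2 : ℝ≥0∞) with hm
  -- Only the differences matter, and they are mirror images in the diagonal. On A \ B one has z.1 ≤
  -- z.2, where reflection does not lower the density.
  have key : m (A \ B) ≤ m (B \ A) := by
    rw [hm, withDensity_apply _ (mA.diff mB), withDensity_apply _ (mB.diff mA)]
    have hswap : B \ A = Prod.swap ⁻¹' (A \ B) := by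
      ext ⟨x, y⟩
      simp [A, B, add_comm]
    have e : ∫⁻ z in A \ B, (g z.2 : ℝ≥0∞) * (f z.1 : ℝ≥0∞) ∂(volume.prod volume : Measure (ℝ × ℝ))
        = ∫⁻ z in B \ A, (g z.1 : ℝ≥0∞) * (f z.2 : ℝ≥0∞) ∂(volume.prod volume) := by
      rw [hswap]
      exact (Measure.measurePreserving_swap (μ := (volume : Measure ℝ))
        (ν := (volume : Measure ℝ))).setLIntegral_comp_preimage (mA.diff mB)
        (f := fun z : ℝ × ℝ => (g z.2 : ℝ≥0∞) * (f z.1 : ℝ≥0∞)) (by fun_prop) |>.symm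
    rw [← e]
    refine setLIntegral_mono (by fun_prop) fun z hz => ?_
    have hz1 : α * z.1 + β * z.2 ≤ s := hz.1
    have hz2 : ¬ (β * z.1 + α * z.2 ≤ s) := hz.2
    have hlt : z.1 ≤ z.2 := by
      by_contra hcon
      nlinarith [mul_nonneg (sub_nonneg.2 hβα) (sub_nonneg.2 (not_le.1 hcon).le)]
    exact_mod_cast hfg z.2 z.1 hlt
  calc m A = m (A ∩ B) + m (A \ B) := (measure_inter_add_sdiff A mB).symm
    _ ≤ m (B ∩ A) + m (B \ A) := by rw [Set.inter_comm]; exact add_le_add le_rfl key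
    _ = m B := measure_inter_add_sdiff B mA

/-- The perspective `(c, y) ↦ c * |y / c| ^ r` of the power function is jointly convex. -/
theorem rpow_one_sub_mul_abs_rpow_convex {r : ℝ} (hr : 1 ≤ r) {α β c d : ℝ} (hα : 0 < α)
    (hβ : 0 < β) (hc : 0 < c) (hd : 0 < d) (x y : ℝ) :
    (α * c + β * d) ^ (1 - r) * |α * x + β * y| ^ r ≤
      α * (c ^ (1 - r) * |x| ^ r) + β * (d ^ (1 - r) * |y| ^ r) := by
  have persp : ∀ e : ℝ, 0 < e → ∀ w : ℝ, e ^ (1 - r) * |w| ^ r = e * (|w| / e) ^ r := by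
    intro e he w
    rw [Real.div_rpow (abs_nonneg w) he.le, Real.rpow_sub he, Real.rpow_one]
    ring
  have hC : 0 < α * c + β * d := by positivity
  rw [persp _ hC, persp c hc, persp d hd]
  -- Jensen for the slopes |x|/c and |y|/d, with weights proportional to αc and βd.
  have hconv := (convexOn_rpow hr).2
    (show |x| / c ∈ Set.Ici (0 : ℝ) by simp only [Set.mem_Ici]; positivity)
    (show |y| / d ∈ Set.Ici (0 : ℝ) by simp only [Set.mem_Ici]; positivity)
    (show 0 ≤ α * c / (α * c + β * d) by positivity)
    (show 0 ≤ β * d / (α * c + β * d) by positivity) (by field_simp)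
  simp only [smul_eq_mul] at hconv
  have hle : |α * x + β * y| / (α * c + β * d) ≤
      α * c / (α * c + β * d) * (|x| / c) + β * d / (α * c + β * d) * (|y| / d) := by
    have : |α * x + β * y| ≤ α * |x| + β * |y| := by
      refine (abs_add_le _ _).trans_eq ?_
      rw [abs_mul, abs_mul, abs_of_pos hα, abs_of_pos hβ]
    rw [div_le_iff₀ hC]
    refine this.trans_eq ?_
    field_simp
  have h2 := (Real.rpow_le_rpow (by positivity) hle (by linarith : (0:ℝ) ≤ r)).trans hconv
  refine (mul_le_mul_of_nonneg_left h2 hC.le).trans_eq ?_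
  field_simp

theorem LogConcaveOn.rpow_mul_rpow_le {h : ℝ → ℝ≥0} (hh : LogConcaveOn Set.univ h) {α β : ℝ}
    (hα : 0 < α) (hβ : 0 < β) (hαβ : α + β = 1) (x y : ℝ) :
    (h x : ℝ≥0∞) ^ α * (h y : ℝ≥0∞) ^ β ≤ (h (α * x + β * y) : ℝ≥0∞) := by
  have := hh.2 x trivial y trivial α hα.le (by linarith)
  rw [show 1 - α = β by linarith] at this
  rw [← ENNReal.coe_rpow_of_nonneg _ hα.le, ← ENNReal.coe_rpow_of_nonneg _ hβ.le]
  exact_mod_cast this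

/-- The distribution function of `c ^ (1 - r) * |U| ^ r + d ^ (1 - r) * |V| ^ r` is log-concave
in `(c, d)` if `U` and `V` are independent with log-concave densities. -/
theorem prod_measure_rpow_le_logConcave {h₁ h₂ : ℝ → ℝ≥0} (m₁ : Measurable h₁)
    (m₂ : Measurable h₂) (lc₁ : LogConcaveOn Set.univ h₁) (lc₂ : LogConcaveOn Set.univ h₂)
    {r : ℝ} (hr : 1 ≤ r) {α β : ℝ} (hα : 0 < α) (hβ : 0 < β) (hαβ : α + β = 1)
    {c d c' d' : ℝ} (hc : 0 < c) (hd : 0 < d) (hc' : 0 < c') (hd' : 0 < d') (s : ℝ) :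
    ((volume.withDensity fun x => (h₁ x : ℝ≥0∞)).prod (volume.withDensity fun x => (h₂ x : ℝ≥0∞)))
        {z : ℝ × ℝ | c ^ (1 - r) * |z.1| ^ r + d ^ (1 - r) * |z.2| ^ r ≤ s} ^ α *
      ((volume.withDensity fun x => (h₁ x : ℝ≥0∞)).prod (volume.withDensity fun x => (h₂ x : ℝ≥0∞)))
        {z : ℝ × ℝ | c' ^ (1 - r) * |z.1| ^ r + d' ^ (1 - r) * |z.2| ^ r ≤ s} ^ β ≤
      ((volume.withDensity fun x => (h₁ x : ℝ≥0∞)).prod (volume.withDensity fun x => (h₂ x : ℝ≥0∞)))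
        {z : ℝ × ℝ | (α * c + β * c') ^ (1 - r) * |z.1| ^ r +
          (α * d + β * d') ^ (1 - r) * |z.2| ^ r ≤ s} := by
  have hms : ∀ a b : ℝ, MeasurableSet {z : ℝ × ℝ | a * |z.1| ^ r + b * |z.2| ^ r ≤ s} :=
    fun a b => measurableSet_le (by fun_prop) measurable_const
  rw [prod_withDensity m₁.coe_nnreal_ennreal m₂.coe_nnreal_ennreal,
    withDensity_apply _ (hms _ _), withDensity_apply _ (hms _ _), withDensity_apply _ (hms _ _),
    ← lintegral_indicator (hms _ _), ← lintegral_indicator (hms _ _),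
    ← lintegral_indicator (hms _ _), ← Measure.volume_eq_prod]
  have hmd : Measurable fun z : ℝ × ℝ => (h₁ z.1 : ℝ≥0∞) * (h₂ z.2 : ℝ≥0∞) := by fun_prop
  refine prekopa_leindler_real_prod hα hβ hαβ (hmd.indicator (hms _ _)) (hmd.indicator (hms _ _))
    (hmd.indicator (hms _ _)) fun z w => ?_
  by_cases hz : z ∈ {z : ℝ × ℝ | c ^ (1 - r) * |z.1| ^ r + d ^ (1 - r) * |z.2| ^ r ≤ s}
  swap
  · simp [Set.indicator_of_notMem hz, hα]
  by_cases hw : w ∈ {z : ℝ × ℝ | c' ^ (1 - r) * |z.1| ^ r + d' ^ (1 - r) * |z.2| ^ r ≤ s}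
  swap
  · simp [Set.indicator_of_notMem hw, hβ]
  rw [Set.indicator_of_mem hz, Set.indicator_of_mem hw, Set.indicator_of_mem]
  · rw [ENNReal.mul_rpow_of_nonneg _ _ hα.le, ENNReal.mul_rpow_of_nonneg _ _ hβ.le,
      mul_mul_mul_comm]
    exact mul_le_mul' (lc₁.rpow_mul_rpow_le hα hβ hαβ _ _) (lc₂.rpow_mul_rpow_le hα hβ hαβ _ _)
  · have e1 := rpow_one_sub_mul_abs_rpow_convex hr hα hβ hc hc' z.1 w.1
    have e2 := rpow_one_sub_mul_abs_rpow_convex hr hα hβ hd hd' z.2 w.2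
    have hz' : c ^ (1 - r) * |z.1| ^ r + d ^ (1 - r) * |z.2| ^ r ≤ s := hz
    have hw' : c' ^ (1 - r) * |w.1| ^ r + d' ^ (1 - r) * |w.2| ^ r ≤ s := hw
    change (α * c + β * c') ^ (1 - r) * |α * z.1 + β * w.1| ^ r +
      (α * d + β * d') ^ (1 - r) * |α * z.2 + β * w.2| ^ r ≤ s
    have h3 := mul_le_mul_of_nonneg_left hz' hα.le
    have h4 := mul_le_mul_of_nonneg_left hw' hβ.le
    have h5 : α * s + β * s = s := by rw [← add_mul, hαβ, one_mul]
    linarith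

/-- Averaging the two weights makes the two-variable sum stochastically smaller. -/
theorem prod_measure_le_of_transfer {ν₁ ν₂ : Measure ℝ} [IsProbabilityMeasure ν₁]
    [IsProbabilityMeasure ν₂] {f g h₁ h₂ : ℝ → ℝ≥0} (hf : Measurable f) (hg : Measurable g)
    (hfg : ∀ x y, y ≤ x → g y * f x ≤ g x * f y)
    (hνg : ν₁ = volume.withDensity fun x => (g x : ℝ≥0∞))
    (hνf : ν₂ = volume.withDensity fun x => (f x : ℝ≥0∞))
    (m₁ : Measurable h₁) (m₂ : Measurable h₂)
    (lc₁ : LogConcaveOn Set.univ h₁) (lc₂ : LogConcaveOn Set.univ h₂)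
    {r : ℝ} (hr : 1 ≤ r)
    (hν₁ : ν₁ = (volume.withDensity fun x => (h₁ x : ℝ≥0∞)).map fun y => |y| ^ r)
    (hν₂ : ν₂ = (volume.withDensity fun x => (h₂ x : ℝ≥0∞)).map fun y => |y| ^ r)
    {c d u v : ℝ} (hc : 0 < c) (hcu : c ≤ u) (hud : u ≤ d) (huv : u + v = c + d) (s : ℝ) :
    (ν₁.prod ν₂) {z : ℝ × ℝ | c ^ (1 - r) * z.1 + d ^ (1 - r) * z.2 ≤ s} ≤
      (ν₁.prod ν₂) {z : ℝ × ℝ | u ^ (1 - r) * z.1 + v ^ (1 - r) * z.2 ≤ s} := by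
  have hd : 0 < d := by linarith
  have hswap : (ν₁.prod ν₂) {z : ℝ × ℝ | c ^ (1 - r) * z.1 + d ^ (1 - r) * z.2 ≤ s} ≤
      (ν₁.prod ν₂) {z : ℝ × ℝ | d ^ (1 - r) * z.1 + c ^ (1 - r) * z.2 ≤ s} := by
    have i1 : IsFiniteMeasure ((volume : Measure ℝ).withDensity fun x => (f x : ℝ≥0∞)) :=
      hνf ▸ inferInstance
    have i2 : IsFiniteMeasure ((volume : Measure ℝ).withDensity fun x => (g x : ℝ≥0∞)) :=
      hνg ▸ inferInstance
    rw [hνg, hνf]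
    exact prod_measure_le_swap hf hg hfg
      (Real.rpow_le_rpow_of_nonpos hc (hcu.trans hud) (by linarith)) s
  -- The endpoints are the pair itself and its swap; removing them leaves c < d and strictly
  -- positive weights.
  rcases hcu.eq_or_lt with rfl | hcu
  · rw [show v = d by linarith]
  rcases hud.eq_or_lt with rfl | hud
  · rwa [show v = c by linarith]
  have hφ : Measurable fun y : ℝ => |y| ^ r := by fun_prop
  have hmap : ∀ a b : ℝ, (ν₁.prod ν₂) {z : ℝ × ℝ | a * z.1 + b * z.2 ≤ s} =
      ((volume.withDensity fun x => (h₁ x : ℝ≥0∞)).prod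
        (volume.withDensity fun x => (h₂ x : ℝ≥0∞)))
        {z : ℝ × ℝ | a * |z.1| ^ r + b * |z.2| ^ r ≤ s} := by
    intro a b
    rw [hν₁, hν₂, Measure.map_prod_map _ _ hφ hφ, Measure.map_apply (by fun_prop)
      (measurableSet_le (by fun_prop) measurable_const)]
    rfl
  have hcd : 0 < d - c := by linarith
  -- These weights express (u, v) as a convex combination of (c, d) and (d, c).
  have hα : 0 < (d - u) / (d - c) := div_pos (by linarith) hcd
  have hβ : 0 < (u - c) / (d - c) := div_pos (by linarith) hcd
  have hαβ : (d - u) / (d - c) + (u - c) / (d - c) = 1 := by field_simp; ring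
  have key := prod_measure_rpow_le_logConcave m₁ m₂ lc₁ lc₂ hr hα hβ hαβ hc hd hd hc s
  rw [← hmap, ← hmap, ← hmap,
    show (d - u) / (d - c) * c + (u - c) / (d - c) * d = u by field_simp; ring,
    show (d - u) / (d - c) * d + (u - c) / (d - c) * c = v by
      rw [show v = c + d - u by linarith]; field_simp; ring] at key
  refine le_trans ?_ key
  set P := (ν₁.prod ν₂) {z : ℝ × ℝ | c ^ (1 - r) * z.1 + d ^ (1 - r) * z.2 ≤ s}
  calc P = P ^ ((d - u) / (d - c)) * P ^ ((u - c) / (d - c)) := by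
        rw [← ENNReal.rpow_add_of_nonneg _ _ hα.le hβ.le, hαβ, ENNReal.rpow_one]
    _ ≤ _ := mul_le_mul_right (ENNReal.rpow_le_rpow hswap hβ.le) _

/-! ### Weak supermajorization through adjacent transfers -/

/-- `Q` does not decrease when, in a vector with positive entries, the mass of an adjacent ordered
pair of entries is redistributed between the two entries without leaving their range. -/
def AdjacentTransferMono {n : ℕ} (Q : (Fin n → ℝ) → ℝ≥0∞) : Prop :=
  ∀ (c d : Fin n → ℝ) (i j : Fin n), (j : ℕ) = i + 1 → (∀ k, 0 < c k) → c i ≤ d i → d i ≤ c j →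
    d i + d j = c i + c j → (∀ k, k ≠ i → k ≠ j → d k = c k) → Q c ≤ Q d

/-- The vector obtained from `c` by moving the mass `ε` from the entry `j` to the entry `i`. -/
def transfer {n : ℕ} (c : Fin n → ℝ) (i j : Fin n) (ε : ℝ) : Fin n → ℝ :=
  fun k => c k + (if k = i then ε else 0) - (if k = j then ε else 0)

theorem transfer_left {n : ℕ} (c : Fin n → ℝ) {i j : Fin n} (h : i ≠ j) (ε : ℝ) :
    transfer c i j ε i = c i + ε := by simp [transfer, h]

theorem transfer_right {n : ℕ} (c : Fin n → ℝ) {i j : Fin n} (h : i ≠ j) (ε : ℝ) :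
    transfer c i j ε j = c j - ε := by simp [transfer, h.symm]

theorem transfer_of_ne {n : ℕ} (c : Fin n → ℝ) {i j k : Fin n} (hi : k ≠ i) (hj : k ≠ j) (ε : ℝ) :
    transfer c i j ε k = c k := by simp [transfer, hi, hj]

/-- A transfer between distant entries is a composition of adjacent transfers. -/
theorem AdjacentTransferMono.le_transfer {n : ℕ} {Q : (Fin n → ℝ) → ℝ≥0∞}
    (hQ : AdjacentTransferMono Q) {c : Fin n → ℝ} (hc : ∀ k, 0 < c k) (hmono : Monotone c)
    {j : Fin n} {ε : ℝ} (hε : 0 ≤ ε) (hj : ∀ k < j, c k ≤ c j - ε) (m : ℕ) :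
    ∀ i : Fin n, (j : ℕ) = i + 1 + m → Q c ≤ Q (transfer c i j ε) := by
  induction m with
  | zero =>
    intro i hij
    have hlt : i < j := Fin.lt_def.2 (by omega)
    have hne := hlt.ne
    refine hQ _ _ i j hij hc ?_ ?_ ?_ fun k hi hk => transfer_of_ne c hi hk ε
    · rw [transfer_left c hne]; linarith
    · rw [transfer_left c hne]; linarith [hj i hlt]
    · rw [transfer_left c hne, transfer_right c hne]; ring
  | succ m ih =>
    intro i hij
    obtain ⟨l, hl⟩ : ∃ l : Fin n, (l : ℕ) = i + 1 := ⟨⟨i + 1, by omega⟩, rfl⟩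
    have hil : i < l := Fin.lt_def.2 (by omega)
    have hlj : l < j := Fin.lt_def.2 (by omega)
    have hij' := (hil.trans hlj).ne
    -- Mass ε goes from j to l, then from l to i. The intermediate vector need not be increasing;
    -- only the order of the entries i and l is used.
    refine (ih l (by omega)).trans (hQ _ _ i l hl (fun k => ?_) ?_ ?_ ?_ fun k hi hk => ?_)
    · have h0 := hc k
      have h1 := (hc l).trans_le (hj l hlj)
      rcases eq_or_ne k l with rfl | hkl
      · rw [transfer_left c hlj.ne]; linarith
      rcases eq_or_ne k j with rfl | hkj
      · rwa [transfer_right c hlj.ne]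
      · rwa [transfer_of_ne c hkl hkj]
    · rw [transfer_of_ne c hil.ne hij', transfer_left c hij']; linarith
    · rw [transfer_left c hij', transfer_left c hlj.ne]
      linarith [hmono hil.le]
    · rw [transfer_left c hij', transfer_left c hlj.ne, transfer_of_ne c hil.ne hij',
        transfer_of_ne c hil.ne' hlj.ne]
      ring
    · rcases eq_or_ne k j with rfl | hkj
      · rw [transfer_right c hij', transfer_right c hlj.ne]
      · rw [transfer_of_ne c hi hkj, transfer_of_ne c hk hkj]

/-- Monotonicity along majorization of increasing vectors. -/
theorem AdjacentTransferMono.le_of_majorized {n : ℕ} {Q : (Fin n → ℝ) → ℝ≥0∞}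
    (hQ : AdjacentTransferMono Q) {d : Fin n → ℝ} (hd : ∀ k, 0 < d k) (hdm : Monotone d) (N : ℕ) :
    ∀ c : Fin n → ℝ, (Finset.univ.filter fun k => c k ≠ d k).card ≤ N → (∀ k, 0 < c k) →
      Monotone c → (∀ m, ∑ k ∈ Finset.Iic m, c k ≤ ∑ k ∈ Finset.Iic m, d k) →
      ∑ k, c k = ∑ k, d k → Q c ≤ Q d := by
  induction N with
  | zero =>
    intro c hN _ _ _ _
    have : c = d := by
      funext k
      by_contra hk
      rw [Nat.le_zero, Finset.card_eq_zero, Finset.filter_eq_empty_iff] at hN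
      exact hN (Finset.mem_univ k) hk
    rw [this]
  | succ N ih =>
    intro c hN hc hcm hpart hsum
    rcases eq_or_ne c d with rfl | hne
    · exact le_rfl
    have hex : ∃ j, d j < c j := by
      by_contra! hcon
      exact hne (funext fun k =>
        (Finset.sum_eq_sum_iff_of_le fun k _ => hcon k).1 hsum k (Finset.mem_univ k))
    -- Take j as the first entry that is too large and i as the last deficient entry before it. The
    -- entries strictly between agree, so the transfer preserves monotonicity.
    obtain ⟨j, hj, hjmin⟩ := WellFounded.has_min (wellFounded_lt (α := Fin n)) {j | d j < c j} hex
    replace hj : d j < c j := hj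
    replace hjmin : ∀ k < j, c k ≤ d k := fun k hk => not_lt.1 fun h => hjmin k h hk
    have hex' : ∃ i, i < j ∧ c i < d i := by
      by_contra! hcon
      refine absurd (hpart j) (not_le.2 (Finset.sum_lt_sum (fun k hk => ?_) ⟨j, by simp, hj⟩))
      rcases (Finset.mem_Iic.1 hk).eq_or_lt with rfl | hk
      · exact hj.le
      · exact hcon k hk
    obtain ⟨i, ⟨hij, hi⟩, himax⟩ :=
      WellFounded.has_min (wellFounded_gt (α := Fin n)) {i | i < j ∧ c i < d i} hex'
    have hmid : ∀ k, i < k → k < j → c k = d k := fun k hik hkj =>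
      le_antisymm (hjmin k hkj) (not_lt.1 fun h => himax k ⟨hkj, h⟩ hik)
    -- The largest amount that overshoots neither target: entry i or j becomes correct, so fewer
    -- entries disagree.
    set ε := min (d i - c i) (c j - d j) with hεdef
    have hε : 0 < ε := lt_min (by linarith) (by linarith)
    have hε1 : ε ≤ d i - c i := min_le_left _ _
    have hε2 : ε ≤ c j - d j := min_le_right _ _
    have hdij := hdm hij.le
    have hmono : Monotone (transfer c i j ε) := by
      intro k l hkl
      rcases hkl.eq_or_lt with rfl | hlt
      · exact le_rfl
      have h1 := hcm hkl
      have h2 := hdm hkl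
      rcases eq_or_ne k i with rfl | hki
      · rw [transfer_left c hij.ne]
        rcases lt_trichotomy l j with hl | rfl | hl
        · rw [transfer_of_ne c hlt.ne' hl.ne, hmid l hlt hl]; linarith
        · rw [transfer_right c hij.ne]; linarith
        · rw [transfer_of_ne c hlt.ne' hl.ne']; linarith [hcm hl.le]
      rcases eq_or_ne k j with rfl | hkj
      · rw [transfer_right c hij.ne, transfer_of_ne c (hij.trans hlt).ne' hlt.ne']; linarith
      rw [transfer_of_ne c hki hkj]
      rcases eq_or_ne l i with rfl | hli
      · rw [transfer_left c hij.ne]; linarith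
      rcases eq_or_ne l j with rfl | hlj
      · rw [transfer_right c hij.ne]
        rcases lt_or_gt_of_ne hki with h | h
        · linarith [hcm h.le]
        · rw [hmid k h hlt]; linarith
      · rwa [transfer_of_ne c hli hlj]
    have hle : Q c ≤ Q (transfer c i j ε) := by
      refine hQ.le_transfer hc hcm hε.le (fun k hk => ?_) (j - (i + 1)) i ?_
      · linarith [hjmin k hk, hdm hk.le]
      · have := Fin.lt_def.1 hij
        omega
    refine hle.trans (ih _ ?_ (fun k => ?_) hmono (fun m => ?_) ?_)
    · rw [← Nat.lt_succ_iff]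
      refine lt_of_lt_of_le (Finset.card_lt_card ?_) hN
      have key : ∀ k, transfer c i j ε k ≠ d k → c k ≠ d k := by
        intro k hk
        rcases eq_or_ne k i with rfl | hki
        · exact hi.ne
        rcases eq_or_ne k j with rfl | hkj
        · exact hj.ne'
        · rwa [transfer_of_ne c hki hkj] at hk
      rw [Finset.ssubset_iff_of_subset (Finset.monotone_filter_right _ fun k _ => key k)]
      rcases min_choice (d i - c i) (c j - d j) with h | h
      · refine ⟨i, by simp [hi.ne], ?_⟩
        rw [Finset.mem_filter, transfer_left c hij.ne, hεdef, h]
        simp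
      · refine ⟨j, by simp [hj.ne'], ?_⟩
        rw [Finset.mem_filter, transfer_right c hij.ne, hεdef, h]
        simp
    · rcases eq_or_ne k i with rfl | hki
      · rw [transfer_left c hij.ne]; linarith [hc k]
      rcases eq_or_ne k j with rfl | hkj
      · rw [transfer_right c hij.ne]; linarith [hd k]
      · rw [transfer_of_ne c hki hkj]; exact hc k
    · simp only [transfer, Finset.sum_sub_distrib, Finset.sum_add_distrib, Finset.sum_ite_eq',
        Finset.mem_Iic]
      have h1 := hpart m
      by_cases him : i ≤ m
      · by_cases hjm : j ≤ m
        · simpa [him, hjm] using h1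
        -- For i ≤ m < j the partial sum gains ε, which is covered by the deficit at i alone, every
        -- deficit before j being nonnegative.
        · have h2 : d i - c i ≤ ∑ k ∈ Finset.Iic m, (d k - c k) :=
            Finset.single_le_sum (f := fun k => d k - c k)
              (fun k hk => sub_nonneg.2
                (hjmin k ((Finset.mem_Iic.1 hk).trans_lt (not_le.1 hjm))))
              (Finset.mem_Iic.2 him)
          rw [Finset.sum_sub_distrib] at h2
          simp only [him, hjm, if_true, if_false]
          linarith
      · have hjm : ¬ j ≤ m := fun h => him (hij.le.trans h)
        simpa [him, hjm] using h1
    · simp [transfer, Finset.sum_sub_distrib, Finset.sum_add_distrib, hsum]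

/-- Monotonicity along weak supermajorization of increasing vectors. -/
theorem AdjacentTransferMono.le_of_weaklySupmajorized {n : ℕ} {Q : (Fin n → ℝ) → ℝ≥0∞}
    (hQ : AdjacentTransferMono Q)
    (hQm : ∀ c d : Fin n → ℝ, (∀ k, 0 < c k) → (∀ k, c k ≤ d k) → Q c ≤ Q d)
    {c d : Fin n → ℝ} (hc : ∀ k, 0 < c k) (hd : ∀ k, 0 < d k) (hcm : Monotone c) (hdm : Monotone d)
    (hpart : ∀ m, ∑ k ∈ Finset.Iic m, c k ≤ ∑ k ∈ Finset.Iic m, d k) : Q c ≤ Q d := by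
  rcases n with _ | n
  · rw [Subsingleton.elim c d]
  have hlast : Finset.Iic (Fin.last n) = Finset.univ := by
    ext k
    simp [Fin.le_last]
  have htot := hpart (Fin.last n)
  rw [hlast] at htot
  set δ := ∑ k, d k - ∑ k, c k with hδ
  have hδ0 : 0 ≤ δ := sub_nonneg.2 htot
  -- Putting the whole missing mass on the last entry equalizes the totals, keeps the vector
  -- increasing and leaves the shorter partial sums unchanged.
  set e : Fin (n + 1) → ℝ := fun k => c k + if k = Fin.last n then δ else 0 with he
  have hce : ∀ k, c k ≤ e k := fun k => by
    simp only [he]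
    split_ifs <;> linarith
  have hne : ∀ k, k ≠ Fin.last n → e k = c k := fun k hk => by simp [he, hk]
  refine (hQm c e hc hce).trans (hQ.le_of_majorized hd hdm _ e le_rfl
    (fun k => (hc k).trans_le (hce k)) (fun k l hkl => ?_) (fun m => ?_) ?_)
  · rcases hkl.eq_or_lt with rfl | hlt
    · exact le_rfl
    rw [hne k (hlt.trans_le (Fin.le_last l)).ne]
    exact (hcm hkl).trans (hce l)
  · rcases eq_or_ne m (Fin.last n) with rfl | hm
    · rw [hlast]
      simp [he, Finset.sum_add_distrib, hδ]
    · refine le_trans (Finset.sum_congr rfl fun k hk => hne k ?_).le (hpart m)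
      exact ((Finset.mem_Iic.1 hk).trans_lt (lt_of_le_of_ne (Fin.le_last m) hm)).ne
  · simp [he, Finset.sum_add_distrib, hδ]

/-! ### Reduction of the theorem to transfers -/

/-- Sorting permutations need not be unique, but any two monotone rearrangements of a vector
coincide. -/
theorem orderStat_comp_antitoneOn {n : ℕ} {x : Fin n → ℝ} {φ : ℝ → ℝ} {s : Set ℝ}
    (hφ : AntitoneOn φ s) (hx : ∀ i, x i ∈ s) (i : Fin n) :
    orderStat (fun i => φ (x i)) i = φ (orderStat x i.rev) := by
  have hmono : Monotone ((fun i => φ (x i)) ∘ (Fin.revPerm.trans (Tuple.sort x))) :=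
    fun k l hkl => hφ (hx _) (hx _) (Tuple.monotone_sort x (Fin.rev_le_rev.2 hkl))
  exact (congrFun (Tuple.comp_sort_eq_comp_iff_monotone.2 hmono) i).symm

/-- The absolute value changes nothing almost surely, and makes the power convex on all of ℝ when 1
/ p ≥ 1. -/
theorem map_eq_map_abs_rpow {Ω : Type*} [MeasurableSpace Ω] {μ : Measure Ω} {X : Ω → ℝ}
    (hX : Measurable X) (hX0 : ∀ᵐ ω ∂μ, 0 ≤ X ω) {p : ℝ} (hp : p ≠ 0) {h : ℝ → ℝ≥0}
    (hh : IsDensityOf μ (fun ω => X ω ^ p) h) :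
    μ.map X = (volume.withDensity fun x => (h x : ℝ≥0∞)).map fun y => |y| ^ (1 / p) := by
  rw [← hh.2, Measure.map_map (by fun_prop) (by fun_prop)]
  refine Measure.map_congr ?_
  filter_upwards [hX0] with ω hω
  simp only [Function.comp_apply]
  rw [abs_of_nonneg (Real.rpow_nonneg hω _), ← Real.rpow_mul hω, mul_one_div_cancel hp,
    Real.rpow_one]

/-- Conditioning on the independent remaining summands reduces a transfer to two variables. -/
theorem measure_sum_le_eq_lintegral {Ω : Type*} [MeasurableSpace Ω] {μ : Measure Ω}
    [IsProbabilityMeasure μ] {n : ℕ} {X : Fin n → Ω → ℝ} (hmeas : ∀ i, Measurable (X i))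
    (hindep : iIndepFun X μ) {i j : Fin n} (hij : i ≠ j) (w : Fin n → ℝ) (t : ℝ) :
    μ {ω | ∑ k, w k * X k ω ≤ t} =
      ∫⁻ y, ((μ.map (X i)).prod (μ.map (X j))) {z : ℝ × ℝ | w i * z.1 + w j * z.2 ≤ t - y}
        ∂(μ.map fun ω => ∑ k ∈ ({i, j} : Finset (Fin n))ᶜ, w k * X k ω) := by
  classical
  have hZ : Measurable fun ω => ∑ k ∈ ({i, j} : Finset (Fin n))ᶜ, w k * X k ω := by fun_prop
  have hind : IndepFun (fun ω => (X i ω, X j ω))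
      (fun ω => ∑ k ∈ ({i, j} : Finset (Fin n))ᶜ, w k * X k ω) μ := by
    have h := (hindep.indepFun_finset {i, j} ({i, j} : Finset (Fin n))ᶜ disjoint_compl_right
      hmeas).comp
      (φ := fun x : ({i, j} : Finset (Fin n)) → ℝ => (x ⟨i, by simp⟩, x ⟨j, by simp⟩))
      (ψ := fun x : (({i, j} : Finset (Fin n))ᶜ : Finset (Fin n)) → ℝ =>
        ∑ k : (({i, j} : Finset (Fin n))ᶜ : Finset (Fin n)), w k * x k) (by fun_prop) (by fun_prop)
    refine h.congr .rfl (.of_forall fun ω => ?_)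
    exact Finset.sum_coe_sort (({i, j} : Finset (Fin n))ᶜ) fun k => w k * X k ω
  have hpair := (hindep.indepFun hij).map_prod_eq_prod_map_map (hmeas i).aemeasurable
    (hmeas j).aemeasurable
  have hlaw := hind.map_prod_eq_prod_map_map
    ((hmeas i).prodMk (hmeas j)).aemeasurable hZ.aemeasurable
  have hS : MeasurableSet {z : (ℝ × ℝ) × ℝ | w i * z.1.1 + w j * z.1.2 + z.2 ≤ t} :=
    measurableSet_le (by fun_prop) measurable_const
  have hev : μ {ω | ∑ k, w k * X k ω ≤ t} =
      μ.map (fun ω => ((X i ω, X j ω), ∑ k ∈ ({i, j} : Finset (Fin n))ᶜ, w k * X k ω))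
        {z : (ℝ × ℝ) × ℝ | w i * z.1.1 + w j * z.1.2 + z.2 ≤ t} := by
    rw [Measure.map_apply (((hmeas i).prodMk (hmeas j)).prodMk hZ) hS]
    congr 1
    ext ω
    have := Finset.sum_add_sum_compl ({i, j} : Finset (Fin n)) fun k => w k * X k ω
    rw [Finset.sum_pair hij] at this
    rw [Set.mem_ofPred_eq, Set.mem_preimage, Set.mem_ofPred_eq, this]
  have : IsProbabilityMeasure (μ.map fun ω => ∑ k ∈ ({i, j} : Finset (Fin n))ᶜ, w k * X k ω) :=
    Measure.isProbabilityMeasure_map hZ.aemeasurable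
  have (k : Fin n) : IsProbabilityMeasure (μ.map (X k)) :=
    Measure.isProbabilityMeasure_map (hmeas k).aemeasurable
  rw [hev, hlaw, hpair, Measure.prod_apply_symm hS]
  refine lintegral_congr fun y => ?_
  congr 1
  ext z
  simp [le_sub_iff_add_le]

theorem corollary4p3 {Ω : Type*} [MeasurableSpace Ω] (μ : Measure Ω) [IsProbabilityMeasure μ]
    (p q : ℝ) (hp0 : 0 < p) (hp1 : p < 1) (hq : q < 0) (hpq : 1 / p + 1 / q = 1)
    (n : ℕ) (X : Fin n → Ω → ℝ)
    (hmeas : ∀ i, Measurable (X i))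
    (hnonneg : ∀ i, ∀ᵐ ω ∂μ, 0 ≤ X i ω)
    (hindep : iIndepFun X μ)
    (hlr : ∀ i j : Fin n, (j : ℕ) = (i : ℕ) + 1 → LikelihoodRatioLE μ (X j) (X i))
    (hlc : ∀ i, HasLogConcaveDensity μ (fun ω => X i ω ^ p))
    (a b : Fin n → ℝ) (ha : ∀ i, 0 < a i) (hb : ∀ i, 0 < b i)
    (hab : WeakSupmajorizedBy (fun i => b i ^ q) (fun i => a i ^ q)) :
    StochLE μ (fun ω => ∑ i, orderStat b i.rev * X i ω)
      (fun ω => ∑ i, orderStat a i.rev * X i ω) := by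
  have hanti : AntitoneOn (fun x : ℝ => x ^ q) (Set.Ioi 0) :=
    fun x hx y _ hxy => Real.rpow_le_rpow_of_nonpos hx hxy hq.le
  have hord : ∀ x : Fin n → ℝ, (∀ i, 0 < x i) → ∀ i,
      0 < orderStat (fun i => x i ^ q) i ∧
        orderStat (fun i => x i ^ q) i ^ (1 - 1 / p) = orderStat x i.rev := by
    intro x hx i
    have h0 : 0 < orderStat x i.rev := hx _
    rw [orderStat_comp_antitoneOn hanti hx i, show 1 - 1 / p = 1 / q by linarith]
    exact ⟨Real.rpow_pos_of_pos h0 q,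
      by rw [← Real.rpow_mul h0.le, mul_one_div_cancel hq.ne, Real.rpow_one]⟩
  have hr : 1 ≤ 1 / p := (one_le_div hp0).2 hp1.le
  intro t
  -- The exponent 1 - 1 / p equals 1 / q, so it recovers the original weights from the q-th powers.
  let Q : (Fin n → ℝ) → ℝ≥0∞ := fun c => μ {ω | ∑ i, c i ^ (1 - 1 / p) * X i ω ≤ t}
  have hQ : AdjacentTransferMono Q := by
    intro c d i j hij hc hci hdi hsum hrest
    have hne : i ≠ j := fun h => by simp [h] at hij
    obtain ⟨f, g, hf, hg, hfg⟩ := hlr i j hij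
    obtain ⟨h₁, hd₁, lc₁⟩ := hlc i
    obtain ⟨h₂, hd₂, lc₂⟩ := hlc j
    have (k : Fin n) : IsProbabilityMeasure (μ.map (X k)) :=
      Measure.isProbabilityMeasure_map (hmeas k).aemeasurable
    simp only [Q]
    rw [measure_sum_le_eq_lintegral hmeas hindep hne,
      measure_sum_le_eq_lintegral hmeas hindep hne]
    have hZ : (fun ω => ∑ k ∈ ({i, j} : Finset (Fin n))ᶜ, d k ^ (1 - 1 / p) * X k ω) =
        fun ω => ∑ k ∈ ({i, j} : Finset (Fin n))ᶜ, c k ^ (1 - 1 / p) * X k ω := by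
      funext ω
      refine Finset.sum_congr rfl fun k hk => ?_
      simp only [Finset.mem_compl, Finset.mem_insert, Finset.mem_singleton, not_or] at hk
      rw [hrest k hk.1 hk.2]
    rw [hZ]
    refine lintegral_mono fun y => ?_
    exact prod_measure_le_of_transfer hf.1 hg.1 (fun x y => mul_le_mul_of_monotoneOn_div hfg)
      hg.2 hf.2 hd₁.1 hd₂.1 lc₁ lc₂ hr
      (map_eq_map_abs_rpow (hmeas i) (hnonneg i) hp0.ne' hd₁)
      (map_eq_map_abs_rpow (hmeas j) (hnonneg j) hp0.ne' hd₂) (hc i) hci hdi hsum _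
  have hQm : ∀ c d : Fin n → ℝ, (∀ k, 0 < c k) → (∀ k, c k ≤ d k) → Q c ≤ Q d := by
    intro c d hc hcd
    refine measure_mono_ae ?_
    filter_upwards [ae_all_iff.2 hnonneg] with ω hω hle
    refine le_trans (Finset.sum_le_sum fun k _ => ?_) hle
    exact mul_le_mul_of_nonneg_right
      (Real.rpow_le_rpow_of_nonpos (hc k) (hcd k) (by linarith)) (hω k)
  have key := hQ.le_of_weaklySupmajorized hQm (fun k => (hord a ha k).1) (fun k => (hord b hb k).1)
    (Tuple.monotone_sort _) (Tuple.monotone_sort _) hab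
  simp only [Q, (hord a ha _).2, (hord b hb _).2] at key
  exact key
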